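/- Let $S:[0,1]^2\to[0,\infty)$ be continuous, and let $\rho(S)$ be the spectral radius of the integral operator $f\mapsto\int_0^1 S(\cdot,y)f(y)\,dy$ on the (complex) Banach space $C([0,1])$. Assume that $\rho(S)=1$ or $\rho(S)=0$. For $n\ge1$ let $S^{(n)}$ be the $n\times n$ matrix with entries $s^{(n)}_{ij}=\frac1n S\!\left(\frac in,\frac jn\right)$, $1\le i,j\le n$. Then for each $\varepsilon\in(0,1]$, \[ \lim_{n\to\infty}\ \min_{\gamma\in[0,1-\varepsilon]}\det\bigl(I_n-\gamma S^{(n)}\bigr) =\lim_{n\to\infty}\det\bigl(I_n-(1-\varepsilon)S^{(n)}\bigr) =\det\bigl(I-(1-\varepsilon)S\bigr)>0 \] (in particular both limits exist), where $\det(I-\gamma S)$ denotes the Fredholm determinant \[ \det(I-\gamma S)=\sum_{k=0}^{\infty}\frac{(-\gamma)^k}{k!}\int_{[0,1]^k}\det\bigl(S(x_i,x_j)\bigr)_{1\le i,j\le k}\,dx_1\cdots dx_k , \] the term $k=0$ being $1$. -/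

import Mathlib

open MeasureTheory Filter Topology
open scoped unitInterval

/-- The integral operator `(T f)(x) = ∫₀¹ S(x, y) f(y) dy` with continuous real kernel `S`, as a
bounded operator on the (complex) Banach space `C([0,1])` with the uniform norm. -/
noncomputable def kernelOperator (S : C(I × I, ℝ)) : C(I, ℂ) →L[ℂ] C(I, ℂ) :=
  LinearMap.mkContinuous
    { toFun := fun f =>
        { toFun := fun x => ∫ y : I, (S (x, y) : ℂ) * f y
          continuous_toFun := by
            have h : Continuous (Function.uncurry fun (x : I) (y : I) => (S (x, y) : ℂ) * f y) := by
              simp only [Function.uncurry_def]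
              fun_prop
            simpa using continuous_parametric_integral_of_continuous (μ := volume) h
              (isCompact_univ : IsCompact (Set.univ : Set I)) }
      map_add' := by
        intro f g
        ext x
        have hf : Integrable (fun y : I => (S (x, y) : ℂ) * f y) :=
          (by fun_prop : Continuous fun y : I => (S (x, y) : ℂ) * f y).integrable_of_hasCompactSupport
            (HasCompactSupport.of_compactSpace _)
        have hg : Integrable (fun y : I => (S (x, y) : ℂ) * g y) :=
          (by fun_prop : Continuous fun y : I => (S (x, y) : ℂ) * g y).integrable_of_hasCompactSupport
            (HasCompactSupport.of_compactSpace _)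
        simp [mul_add, integral_add hf hg]
      map_smul' := by
        intro c f
        ext x
        simp [mul_left_comm, integral_const_mul] }
    ‖S‖
    (by
      intro f
      refine (ContinuousMap.norm_le _ (by positivity)).2 fun x => ?_
      have h := norm_integral_le_of_norm_le_const (μ := (volume : Measure I))
        (f := fun y : I => (S (x, y) : ℂ) * f y) (C := ‖S‖ * ‖f‖)
        (Eventually.of_forall fun y => by
          rw [norm_mul, Complex.norm_real]
          exact mul_le_mul (S.norm_coe_le_norm _) (f.norm_coe_le_norm _) (norm_nonneg _)
            (norm_nonneg _))
      simpa using h)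

/-- The spectral radius of the integral operator with kernel `S` on `C([0,1])`. -/
noncomputable def kernelSpectralRadius (S : C(I × I, ℝ)) : ENNReal :=
  spectralRadius ℂ (kernelOperator S)

/-- The Fredholm determinant `det(I - T)` of the integral operator `T` with continuous kernel `T`
on `[0,1]²`: the Fredholm series
`∑_{k ≥ 0} ((-1)^k / k!) ∫_{[0,1]^k} det (T(x_i, x_j))_{i,j ≤ k} dx₁ ⋯ dx_k`,
whose `k = 0` term is `1`. -/
noncomputable def fredholmDet (T : C(I × I, ℝ)) : ℝ :=
  ∑' k : ℕ, (-1 : ℝ) ^ k / (k.factorial : ℝ) *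
    ∫ x : Fin k → I, (Matrix.of fun i j : Fin k => T (x i, x j)).det

/-- The sample point `i / n` of `[0,1]`, where the index `i = 1, …, n` is written `i + 1` with
`i : Fin n`. -/
noncomputable def samplePoint (n : ℕ) (i : Fin n) : I :=
  ⟨((i : ℝ) + 1) / n, by
    have hi : ((i : ℕ) : ℝ) + 1 ≤ n := by exact_mod_cast i.isLt
    exact ⟨by positivity, div_le_one_of_le₀ hi (by positivity)⟩⟩

/-- The `n × n` matrix with entries `S(i/n, j/n) / n`, for `i, j = 1, …, n`. -/
noncomputable def sampledMatrix (S : C(I × I, ℝ)) (n : ℕ) : Matrix (Fin n) (Fin n) ℝ :=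
  Matrix.of fun i j => S (samplePoint n i, samplePoint n j) / n

/-! Let `T` be the integral operator, `D(γ) = det(I - γS)`, and `d_n(γ)` the determinant of the
sampled matrix. Both are power series in `γ`. The coefficients of `d_n` are Riemann sums for those
of `D`, and Hadamard's inequality bounds both by one summable sequence. By dominated convergence the
`ℓ¹` distance of the coefficients tends to `0`, so `d_n → D` uniformly on `|γ| ≤ 1`
(`abs_det_sub_fredholmDet_le`). It remains to see that `D` is positive and nonincreasing on `[0,
1)`.

Both follow from Plemelj's formula `D(γ) = exp(-∑_{k ≥ 1} tr(T^k) γ^k / k)`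
(`fredholmDet_smul_eq_exp`), since `S ≥ 0` makes every trace nonnegative. For small `γ` the formula
is the limit of the one for matrices. Traces are bounded by a constant times norms of powers of `T`,
so Gelfand's formula and `ρ(S) ≤ 1` make the series converge for `|γ| < 1`, and the identity theorem
for analytic functions extends the formula there. Eigenvalues never enter. -/

/-! ### Hadamard's inequality and the Fredholm expansion of a matrix determinant. -/

/-- Hadamard's inequality for a matrix with bounded entries. -/
theorem Matrix.abs_det_le_sqrt_mul_pow {k : ℕ} (A : Matrix (Fin k) (Fin k) ℝ) {M : ℝ}
    (h : ∀ i j, |A i j| ≤ M) : |A.det| ≤ (√k * M) ^ k := by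
  rcases Nat.eq_zero_or_pos k with rfl | hk
  · simp
  have hM : 0 ≤ M := (abs_nonneg _).trans (h ⟨0, hk⟩ ⟨0, hk⟩)
  have : Fact (Module.finrank ℝ (EuclideanSpace ℝ (Fin k)) = k) := ⟨by simp⟩
  let b := EuclideanSpace.basisFun (Fin k) ℝ
  let v : Fin k → EuclideanSpace ℝ (Fin k) := fun i => WithLp.toLp 2 (A i)
  -- The volume form is bounded by the product of the norms of the rows, and in absolute value it is
  -- the determinant in any orthonormal basis.
  have h1 := b.toBasis.orientation.abs_volumeForm_apply_le v
  rw [b.toBasis.orientation.volumeForm_robust' b v] at h1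
  have h2 : b.toBasis.det v = A.det := by
    rw [Module.Basis.det_apply, ← Matrix.det_transpose]
    congr 1
  rw [h2] at h1
  refine h1.trans ?_
  calc ∏ i : Fin k, ‖v i‖ ≤ ∏ _i : Fin k, (√k * M) := by
        refine Finset.prod_le_prod (fun _ _ => norm_nonneg _) fun i _ => ?_
        rw [EuclideanSpace.norm_eq]
        refine Real.sqrt_le_iff.2 ⟨by positivity, ?_⟩
        rw [mul_pow, Real.sq_sqrt (by positivity)]
        calc ∑ j, ‖(v i).ofLp j‖ ^ 2 ≤ ∑ _j : Fin k, M ^ 2 := by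
              refine Finset.sum_le_sum fun j _ => ?_
              exact pow_le_pow_left₀ (norm_nonneg _) (h i j) 2
          _ = k * M ^ 2 := by simp
    _ = (√k * M) ^ k := by simp

theorem card_filter_injective_image_eq {n k : ℕ} (s : Finset (Fin n)) (hs : s.card = k) :
    (Finset.univ.filter fun f : Fin k → Fin n =>
      Function.Injective f ∧ Finset.univ.image f = s).card = k.factorial := by
  classical
  have e : {f : Fin k → Fin n // Function.Injective f ∧ Finset.univ.image f = s} ≃
      (Fin k ≃ s) :=
    { toFun := fun f => Equiv.ofBijective
        (fun i => ⟨f.1 i, f.2.2.subset (Finset.mem_image_of_mem _ (Finset.mem_univ i))⟩)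
        ⟨fun i j hij => f.2.1 (congrArg Subtype.val hij), fun y => by
          obtain ⟨i, -, hi⟩ := Finset.mem_image.1 (f.2.2.superset y.2)
          exact ⟨i, Subtype.ext hi⟩⟩
      invFun := fun e => ⟨fun i => e i, fun i j hij => e.injective (Subtype.ext hij), by
        ext y
        simp only [Finset.mem_image, Finset.mem_univ, true_and]
        exact ⟨fun ⟨i, hi⟩ => hi ▸ (e i).2, fun hy => ⟨e.symm ⟨y, hy⟩, by simp⟩⟩⟩
      left_inv := fun f => rfl
      right_inv := fun e => by ext; rfl }
  rw [← Fintype.card_subtype, Fintype.card_congr e,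
    Fintype.card_equiv (Fintype.equivOfCardEq (by simp [hs])), Fintype.card_fin]

/-- A non-injective `f` repeats a row and contributes `0`. Each `k`-subset is the image of `k!`
injections, all giving the same principal minor, because rows and columns are permuted together. -/
theorem Matrix.sum_det_submatrix_eq_factorial_mul {n k : ℕ} (A : Matrix (Fin n) (Fin n) ℝ) :
    ∑ f : Fin k → Fin n, (A.submatrix f f).det =
      k.factorial * ∑ s ∈ Finset.univ.powersetCard k,
        (A.submatrix (Subtype.val : s → Fin n) (Subtype.val : s → Fin n)).det := by
  classical
  have h0 : ∑ f : Fin k → Fin n, (A.submatrix f f).det =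
      ∑ f ∈ Finset.univ.filter (fun f : Fin k → Fin n => Function.Injective f),
        (A.submatrix f f).det := by
    refine (Finset.sum_subset (Finset.filter_subset _ _) fun f _ hf => ?_).symm
    have hf' : ¬ Function.Injective f := fun h => hf (Finset.mem_filter.2 ⟨Finset.mem_univ _, h⟩)
    obtain ⟨i, j, hij, hne⟩ := Function.not_injective_iff.1 hf'
    exact Matrix.det_zero_of_row_eq hne (by ext l; simp [hij])
  rw [h0, ← Finset.sum_fiberwise_of_maps_to (t := Finset.univ.powersetCard k)
    (g := fun f : Fin k → Fin n => Finset.univ.image f), Finset.mul_sum]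
  · refine Finset.sum_congr rfl fun s hs => ?_
    have hs' : s.card = k := (Finset.mem_powersetCard.1 hs).2
    rw [Finset.filter_filter, ← card_filter_injective_image_eq s hs', ← nsmul_eq_mul]
    refine Finset.sum_eq_card_nsmul fun f hf => ?_
    obtain ⟨hinj, rfl⟩ := (Finset.mem_filter.1 hf).2
    have hb : Function.Bijective (fun i => (⟨f i, Finset.mem_image_of_mem _ (Finset.mem_univ i)⟩ :
        {x // x ∈ Finset.univ.image f})) :=
      ⟨fun i j hij => hinj (congrArg Subtype.val hij), fun y => by
        obtain ⟨i, -, hi⟩ := Finset.mem_image.1 y.2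
        exact ⟨i, Subtype.ext hi⟩⟩
    rw [← Matrix.det_submatrix_equiv_self (Equiv.ofBijective _ hb)]
    rfl
  · intro f hf
    simp only [Finset.mem_filter, Finset.mem_univ, true_and] at hf
    simp [Finset.mem_powersetCard, Finset.card_image_of_injective _ hf]

theorem Matrix.eval_det_one_add_X_smul {n : ℕ} (A : Matrix (Fin n) (Fin n) ℝ) (x : ℝ) :
    (1 + (Polynomial.X : Polynomial ℝ) • A.map Polynomial.C).det.eval x = (1 + x • A).det := by
  rw [← Polynomial.coe_evalRingHom, RingHom.map_det]
  congr 1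
  ext i j
  by_cases hij : i = j
  · subst hij
    simpa using mul_comm _ _
  · simpa [hij] using mul_comm _ _

/-- The Fredholm expansion of `det (1 - γ A)` for a finite matrix `A`. -/
theorem Matrix.det_one_sub_smul_eq_tsum {n : ℕ} (A : Matrix (Fin n) (Fin n) ℝ) (γ : ℝ) :
    (1 - γ • A).det =
      ∑' k : ℕ, (-1) ^ k / (k.factorial : ℝ) * (∑ f : Fin k → Fin n, (A.submatrix f f).det)
        * γ ^ k := by
  classical
  set p : Polynomial ℝ := (1 + (Polynomial.X : Polynomial ℝ) • A.map Polynomial.C).det with hp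
  have hc : ∀ k : ℕ, (-1) ^ k / (k.factorial : ℝ) *
      (∑ f : Fin k → Fin n, (A.submatrix f f).det) * γ ^ k = p.coeff k * (-γ) ^ k := by
    intro k
    rw [Matrix.sum_det_submatrix_eq_factorial_mul, hp,
      Matrix.coeff_det_one_add_X_smul_eq_sum_minors, neg_pow γ]
    have := Nat.cast_ne_zero (R := ℝ).2 k.factorial_ne_zero
    field_simp
  simp_rw [hc]
  have he : (1 - γ • A).det = p.eval (-γ) := by
    rw [hp, Matrix.eval_det_one_add_X_smul, neg_smul, sub_eq_add_neg]
  rw [he, Polynomial.eval_eq_sum_range, tsum_eq_sum]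
  intro k hk
  rw [Polynomial.coeff_eq_zero_of_natDegree_lt (by simpa using hk), zero_mul]

/-! ### Plemelj's formula for matrices. -/

theorem hasDerivAt_tsum_pow_succ_div {c : ℕ → ℝ} {r γ : ℝ} (hγ : |γ| < r)
    (hc : Summable fun k => |c k| * r ^ k) :
    HasDerivAt (fun x : ℝ => ∑' k : ℕ, c k / (k + 1) * x ^ (k + 1)) (∑' k : ℕ, c k * γ ^ k) γ := by
  have hr : 0 < r := (abs_nonneg _).trans_lt hγ
  refine hasDerivAt_tsum_of_isPreconnected (𝕜 := ℝ) (F := ℝ)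
    (g := fun k x => c k / (k + 1) * x ^ (k + 1)) (g' := fun k x => c k * x ^ k) (t := Metric.ball (0 : ℝ) r) (y₀ := 0) hc
    Metric.isOpen_ball (convex_ball _ _).isPreconnected (fun k y _ => ?_) (fun k y hy => ?_)
    (Metric.mem_ball_self hr) ?_ (by simpa using hγ)
  · have := ((hasDerivAt_pow (k + 1) y).const_mul (c k / (k + 1)))
    refine this.congr_deriv ?_
    have : (k : ℝ) + 1 ≠ 0 := by positivity
    push_cast
    field_simp
  · rw [norm_mul, norm_pow, Real.norm_eq_abs]
    have hy' : ‖y‖ ≤ r := by simpa using (Metric.mem_ball.1 hy).le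
    gcongr
  · simp

open scoped Matrix.Norms.Operator in
theorem Matrix.abs_trace_le_card_mul_norm {n : ℕ} (A : Matrix (Fin n) (Fin n) ℝ) :
    |A.trace| ≤ n * ‖A‖ := by
  refine (Finset.abs_sum_le_sum_abs _ _).trans ?_
  have : ∀ i ∈ Finset.univ, |A.diag i| ≤ ‖A‖ := fun i _ => by
    rw [Matrix.linfty_opNorm_def]
    have h1 : ‖A i i‖₊ ≤ ∑ j, ‖A i j‖₊ :=
      Finset.single_le_sum (f := fun j => ‖A i j‖₊) (fun _ _ => zero_le) (Finset.mem_univ i)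
    have h2 : ∑ j, ‖A i j‖₊ ≤ Finset.univ.sup fun i => ∑ j, ‖A i j‖₊ :=
      Finset.le_sup (f := fun i => ∑ j, ‖A i j‖₊) (Finset.mem_univ i)
    exact_mod_cast h1.trans h2
  simpa using Finset.sum_le_sum this

/-- Factoring `1 - xA = (1 - γA)(1 - (x - γ)BA)` reduces the derivative at `γ` to that of `det(1 +
tBA)` at `t = 0`, which is a trace. -/
theorem Matrix.hasDerivAt_det_one_sub_smul {n : ℕ} (A : Matrix (Fin n) (Fin n) ℝ) {γ : ℝ}
    {B : Matrix (Fin n) (Fin n) ℝ} (hB : (1 - γ • A) * B = 1) :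
    HasDerivAt (fun x : ℝ => (1 - x • A).det) (-((1 - γ • A).det * (B * A).trace)) γ := by
  set p := (1 + (Polynomial.X : Polynomial ℝ) • (B * A).map Polynomial.C).det with hp
  have h1 : ∀ x : ℝ, (1 - x • A).det = (1 - γ • A).det * p.eval (-(x - γ)) := by
    intro x
    have : p.eval (-(x - γ)) = (1 - (x - γ) • (B * A)).det := by
      rw [hp, Matrix.eval_det_one_add_X_smul, neg_smul, ← sub_eq_add_neg]
    rw [this, ← Matrix.det_mul]
    congr 1
    rw [mul_sub, mul_one, Matrix.mul_smul, ← Matrix.mul_assoc, hB, one_mul, sub_smul]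
    abel
  have h2 : HasDerivAt (fun x : ℝ => p.eval (-(x - γ))) (p.derivative.eval (-(γ - γ)) * (-1)) γ :=
    (p.hasDerivAt _).comp γ ((hasDerivAt_id γ).sub_const γ).neg
  have h3 := h2.const_mul (1 - γ • A).det
  have h4 : (fun x : ℝ => (1 - x • A).det) =
      fun x => (1 - γ • A).det * p.eval (-(x - γ)) := funext h1
  rw [h4]
  refine h3.congr_deriv ?_
  rw [sub_self, neg_zero, hp, Matrix.derivative_det_one_add_X_smul]
  ring

open scoped Matrix.Norms.Operator in
/-- Plemelj's formula for a finite matrix. -/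
theorem Matrix.det_one_sub_smul_eq_exp {n : ℕ} (A : Matrix (Fin n) (Fin n) ℝ) {γ : ℝ}
    (h : |γ| * ‖A‖ < 1) :
    (1 - γ • A).det =
      Real.exp (-∑' k : ℕ, (A ^ (k + 1)).trace / (k + 1) * γ ^ (k + 1)) := by
  obtain ⟨r, hγr, hr⟩ : ∃ r, |γ| < r ∧ r * ‖A‖ < 1 := by
    have : ∀ᶠ r in 𝓝[>] |γ|, r * ‖A‖ < 1 :=
      (((continuous_id.mul continuous_const).tendsto |γ|).eventually_lt_const h).filter_mono
        nhdsWithin_le_nhds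
    obtain ⟨r, hr1, hr2⟩ := (this.and self_mem_nhdsWithin).exists
    exact ⟨r, hr2, hr1⟩
  have hr0 : 0 < r := (abs_nonneg _).trans_lt hγr
  have hbound : ∀ k : ℕ, ‖A ^ (k + 1)‖ ≤ ‖A‖ ^ (k + 1) := fun k => norm_pow_le' A k.succ_pos
  have hs : Summable fun k : ℕ => |(A ^ (k + 1)).trace| * r ^ k := by
    refine Summable.of_nonneg_of_le (fun k => by positivity) (fun k => ?_)
      ((summable_geometric_of_lt_one (by positivity) hr).mul_left (n * ‖A‖))
    calc |(A ^ (k + 1)).trace| * r ^ k ≤ n * ‖A‖ ^ (k + 1) * r ^ k := by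
          gcongr
          exact (Matrix.abs_trace_le_card_mul_norm _).trans (by gcongr; exact hbound k)
      _ = n * ‖A‖ * (r * ‖A‖) ^ k := by ring
  set L : ℝ → ℝ := fun x => ∑' k : ℕ, (A ^ (k + 1)).trace / (k + 1) * x ^ (k + 1) with hL
  -- By the Neumann series, `L'(x)` is the trace of `(1 - xA)⁻¹A`, which cancels the logarithmic
  -- derivative of the determinant. Working with the product `det · exp L` avoids taking a logarithm
  -- of a determinant not yet known to be positive.
  have hd : ∀ x ∈ Metric.ball (0 : ℝ) r,
      HasDerivAt (fun x => (1 - x • A).det * Real.exp (L x)) 0 x := by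
    intro x hx
    have hx' : |x| < r := by simpa using hx
    have hxA : ‖x • A‖ < 1 := by
      rw [norm_smul, Real.norm_eq_abs]
      exact (mul_le_mul_of_nonneg_right hx'.le (norm_nonneg _)).trans_lt hr
    obtain ⟨B, hB, hB1⟩ : ∃ B, HasSum (fun i => (x • A) ^ i) B ∧ (1 - x • A) * B = 1 :=
      ⟨_, (summable_geometric_of_norm_lt_one hxA).hasSum, mul_neg_geom_series (x • A) hxA⟩
    have h1 := A.hasDerivAt_det_one_sub_smul hB1
    have h2 := (hasDerivAt_tsum_pow_succ_div hx' hs).exp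
    have h3 : (B * A).trace = ∑' k : ℕ, (A ^ (k + 1)).trace * x ^ k := by
      have hsum := hB.mul_right A
      have := hsum.map (Matrix.traceAddMonoidHom (Fin n) ℝ) (by
        exact continuous_id.matrix_trace)
      rw [← Matrix.traceAddMonoidHom_apply, ← this.tsum_eq]
      refine tsum_congr fun k => ?_
      simp [smul_pow, pow_succ, mul_comm]
    rw [h3] at h1
    refine (h1.mul h2).congr_deriv ?_
    rw [neg_mul, mul_right_comm, mul_assoc, neg_add_cancel]
  have hconst := IsOpen.eqOn_of_deriv_eq (𝕜 := ℝ) (f := fun x => (1 - x • A).det * Real.exp (L x))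
    (g := fun _ => 1) Metric.isOpen_ball (convex_ball (0 : ℝ) r).isPreconnected
    (fun x hx => (hd x hx).differentiableAt.differentiableWithinAt)
    (differentiableOn_const _) (fun x hx => by rw [(hd x hx).deriv]; simp)
    (Metric.mem_ball_self hr0) (by simp [hL]) (show γ ∈ Metric.ball (0 : ℝ) r by simpa using hγr)
  rw [Real.exp_neg]
  exact eq_inv_of_mul_eq_one_left hconst

/-! ### Riemann sums as integrals of step functions. -/

/-- The index `i` for which `x` lies in `(i / (n + 1), (i + 1) / (n + 1)]`. -/
noncomputable def stepIndex (n : ℕ) (x : I) : Fin (n + 1) :=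
  -- Truncated subtraction gives `x = 0` the index `0`, although `0` lies in none of the half-open
  -- intervals.
  ⟨⌈((n + 1 : ℕ) : ℝ) * x⌉₊ - 1, by
    have h : ⌈((n + 1 : ℕ) : ℝ) * x⌉₊ ≤ n + 1 :=
      Nat.ceil_le.2 (mul_le_of_le_one_right (by positivity) x.2.2)
    omega⟩

theorem measurable_stepIndex (n : ℕ) : Measurable (stepIndex n) := by
  have h : Measurable fun x : I => ⌈((n + 1 : ℕ) : ℝ) * x⌉₊ - 1 :=
    (measurable_from_top (f := fun k : ℕ => k - 1)).comp
      (Nat.measurable_ceil.comp (measurable_subtype_coe.const_mul _))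
  refine measurable_to_countable' fun i => ?_
  have : stepIndex n ⁻¹' {i} = (fun x : I => ⌈((n + 1 : ℕ) : ℝ) * x⌉₊ - 1) ⁻¹' {(i : ℕ)} := by
    ext x
    simp [stepIndex, Fin.ext_iff]
  rw [this]
  exact h (measurableSet_singleton _)

theorem stepIndex_eq_iff {n : ℕ} {x : I} (hx : x ≠ 0) (i : Fin (n + 1)) :
    stepIndex n x = i ↔ (i : ℝ) / (n + 1) < x ∧ (x : ℝ) ≤ (i + 1) / (n + 1) := by
  have hn : (0 : ℝ) < n + 1 := by positivity
  have hx0 : (0 : ℝ) < x := lt_of_le_of_ne x.2.1 fun h => hx (Subtype.ext h.symm)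
  have hc : 0 < ⌈((n + 1 : ℕ) : ℝ) * x⌉₊ := Nat.ceil_pos.2 (by positivity)
  have h1 : stepIndex n x = i ↔ ⌈((n + 1 : ℕ) : ℝ) * x⌉₊ = i + 1 := by
    simp only [stepIndex, Fin.ext_iff]
    omega
  rw [h1, Nat.ceil_eq_iff (Nat.succ_ne_zero _), div_lt_iff₀ hn, le_div_iff₀ hn]
  simp [mul_comm]

theorem volume_preimage_stepIndex (n : ℕ) (i : Fin (n + 1)) :
    volume (stepIndex n ⁻¹' {i}) = ENNReal.ofReal (1 / (n + 1)) := by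
  have hn : (0 : ℝ) < n + 1 := by positivity
  have hi : ((i : ℕ) : ℝ) + 1 ≤ n + 1 := by exact_mod_cast i.isLt
  let a : I := ⟨i / (n + 1), by positivity, (div_le_one hn).2 (by linarith)⟩
  let b : I := ⟨(i + 1) / (n + 1), by positivity, (div_le_one hn).2 hi⟩
  have h : stepIndex n ⁻¹' {i} =ᵐ[volume] Set.Ioc a b := by
    filter_upwards [Measure.ae_ne volume (0 : I)] with x hx
    exact propext (stepIndex_eq_iff hx i)
  rw [measure_congr h, unitInterval.volume_Ioc]
  congr 1
  simp only [a, b]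
  ring

/-- The step map pushes Lebesgue measure on the cube forward to the uniform measure on the grid. -/
theorem integral_comp_stepIndex_pi {k n : ℕ} {E : Type*} [NormedAddCommGroup E] [NormedSpace ℝ E]
    [CompleteSpace E] (G : (Fin k → Fin (n + 1)) → E) :
    ∫ x : Fin k → I, G (fun j => stepIndex n (x j)) =
      (1 / ((n : ℝ) + 1)) ^ k • ∑ f, G f := by
  have hm : Measurable fun (x : Fin k → I) (j : Fin k) => stepIndex n (x j) :=
    measurable_pi_lambda _ fun j => (measurable_stepIndex n).comp (measurable_pi_apply j)
  have : IsFiniteMeasure (Measure.map (fun (x : Fin k → I) (j : Fin k) => stepIndex n (x j))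
    volume) := Measure.isFiniteMeasure_map _ _
  rw [← integral_map (φ := fun (x : Fin k → I) (j : Fin k) => stepIndex n (x j)) hm.aemeasurable
    (StronglyMeasurable.of_discrete).aestronglyMeasurable, integral_fintype Integrable.of_finite,
    Finset.smul_sum]
  refine Finset.sum_congr rfl fun f _ => ?_
  congr 1
  rw [measureReal_def, Measure.map_apply hm (measurableSet_singleton f)]
  have : (fun (x : Fin k → I) (j : Fin k) => stepIndex n (x j)) ⁻¹' {f} =
      Set.pi Set.univ fun j => stepIndex n ⁻¹' {f j} := by
    ext x
    simp [funext_iff]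
  rw [this, volume_pi_pi]
  simp only [volume_preimage_stepIndex, Finset.prod_const, Finset.card_univ, Fintype.card_fin,
    ENNReal.toReal_pow]
  rw [ENNReal.toReal_ofReal (by positivity)]

theorem integral_comp_stepIndex {n : ℕ} {E : Type*} [NormedAddCommGroup E] [NormedSpace ℝ E]
    [CompleteSpace E] (G : Fin (n + 1) → E) :
    ∫ x : I, G (stepIndex n x) = (1 / ((n : ℝ) + 1)) • ∑ i, G i := by
  have : IsFiniteMeasure (Measure.map (stepIndex n) volume) := Measure.isFiniteMeasure_map _ _
  rw [← integral_map (φ := stepIndex n) (measurable_stepIndex n).aemeasurable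
    (StronglyMeasurable.of_discrete).aestronglyMeasurable, integral_fintype Integrable.of_finite,
    Finset.smul_sum]
  refine Finset.sum_congr rfl fun i _ => ?_
  rw [measureReal_def, Measure.map_apply (measurable_stepIndex n) (measurableSet_singleton i),
    volume_preimage_stepIndex, ENNReal.toReal_ofReal (by positivity)]

/-- The sample point to the right of `x`. -/
noncomputable def stepPoint (n : ℕ) (x : I) : I := samplePoint (n + 1) (stepIndex n x)

theorem measurable_stepPoint (n : ℕ) : Measurable (stepPoint n) :=
  (measurable_from_top (f := samplePoint (n + 1))).comp (measurable_stepIndex n)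

theorem dist_stepPoint_le (n : ℕ) (x : I) : dist (stepPoint n x) x ≤ 1 / ((n : ℝ) + 1) := by
  have hn : (0 : ℝ) < n + 1 := by positivity
  rw [Subtype.dist_eq, Real.dist_eq]
  rcases eq_or_ne x 0 with rfl | hx
  · simp [stepPoint, stepIndex, samplePoint, abs_of_pos hn]
  · obtain ⟨h1, h2⟩ := (stepIndex_eq_iff hx (stepIndex n x)).1 rfl
    have h3 : (stepPoint n x : ℝ) = ((stepIndex n x : ℕ) + 1) / (n + 1) := by
      simp [stepPoint, samplePoint]
    rw [h3, abs_of_nonneg (by linarith)]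
    rw [add_div] at h2 ⊢
    linarith

theorem tendsto_stepPoint (x : I) : Tendsto (fun n => stepPoint n x) atTop (𝓝 x) :=
  tendsto_iff_dist_tendsto_zero.2 <| squeeze_zero (fun _ => dist_nonneg)
    (fun n => dist_stepPoint_le n x) tendsto_one_div_add_atTop_nhds_zero_nat

/-! ### Convergence of the Fredholm coefficients. -/

/-- The coefficient of `γ ^ k` in `fredholmDet (γ • S)`. -/
noncomputable def fredholmCoeff (S : C(I × I, ℝ)) (k : ℕ) : ℝ :=
  (-1) ^ k / (k.factorial : ℝ) *
    ∫ x : Fin k → I, (Matrix.of fun i j : Fin k => S (x i, x j)).det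

/-- The coefficient of `γ ^ k` in `det (1 - γ A)` for the matrix `A` sampled at `n + 1` points. -/
noncomputable def sampledCoeff (S : C(I × I, ℝ)) (n k : ℕ) : ℝ :=
  (-1) ^ k / (k.factorial : ℝ) *
    ∑ f : Fin k → Fin (n + 1), ((sampledMatrix S (n + 1)).submatrix f f).det

theorem fredholmDet_smul (S : C(I × I, ℝ)) (γ : ℝ) :
    fredholmDet (γ • S) = ∑' k, fredholmCoeff S k * γ ^ k := by
  refine tsum_congr fun k => ?_
  have h : ∀ x : Fin k → I, (Matrix.of fun i j : Fin k => (γ • S) (x i, x j)).det =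
      γ ^ k * (Matrix.of fun i j : Fin k => S (x i, x j)).det := fun x => by
    have : (Matrix.of fun i j : Fin k => (γ • S) (x i, x j)) =
        γ • Matrix.of fun i j : Fin k => S (x i, x j) := rfl
    rw [this, Matrix.det_smul, Fintype.card_fin]
  simp_rw [h]
  rw [integral_const_mul, fredholmCoeff]
  ring

theorem det_one_sub_smul_sampledMatrix (S : C(I × I, ℝ)) (n : ℕ) (γ : ℝ) :
    (1 - γ • sampledMatrix S (n + 1)).det = ∑' k, sampledCoeff S n k * γ ^ k :=
  Matrix.det_one_sub_smul_eq_tsum _ _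

theorem sampledCoeff_eq_integral (S : C(I × I, ℝ)) (n k : ℕ) :
    sampledCoeff S n k = (-1) ^ k / (k.factorial : ℝ) *
      ∫ x : Fin k → I,
        (Matrix.of fun i j : Fin k => S (stepPoint n (x i), stepPoint n (x j))).det := by
  rw [sampledCoeff]
  congr 1
  have := integral_comp_stepIndex_pi (n := n) (k := k) fun f => (Matrix.of fun i j : Fin k =>
    S (samplePoint (n + 1) (f i), samplePoint (n + 1) (f j))).det
  simp only [stepPoint]
  rw [this, Finset.smul_sum]
  refine Finset.sum_congr rfl fun f _ => ?_
  have h : (sampledMatrix S (n + 1)).submatrix f f = (1 / ((n : ℝ) + 1)) • Matrix.of fun i j =>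
      S (samplePoint (n + 1) (f i), samplePoint (n + 1) (f j)) := by
    ext i j
    simp [sampledMatrix, div_eq_inv_mul]
  rw [h, Matrix.det_smul, Fintype.card_fin, smul_eq_mul]

theorem abs_integral_det_le (S : C(I × I, ℝ)) (k : ℕ) (φ : I → I) :
    |∫ x : Fin k → I, (Matrix.of fun i j : Fin k => S (φ (x i), φ (x j))).det| ≤
      (√k * ‖S‖) ^ k := by
  have := norm_integral_le_of_norm_le_const (μ := (volume : Measure (Fin k → I)))
    (f := fun x => (Matrix.of fun i j : Fin k => S (φ (x i), φ (x j))).det)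
    (C := (√k * ‖S‖) ^ k) (Eventually.of_forall fun x =>
      Matrix.abs_det_le_sqrt_mul_pow _ fun i j => S.norm_coe_le_norm _)
  simpa using this

theorem tendsto_sampledCoeff (S : C(I × I, ℝ)) (k : ℕ) :
    Tendsto (fun n => sampledCoeff S n k) atTop (𝓝 (fredholmCoeff S k)) := by
  simp_rw [sampledCoeff_eq_integral]
  refine Tendsto.const_mul _ ?_
  have hdet : Continuous fun x : Fin k → I =>
      (Matrix.of fun i j : Fin k => S (x i, x j)).det :=
    Continuous.matrix_det (continuous_matrix fun i j => by
      simp only [Matrix.of_apply]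
      fun_prop)
  refine tendsto_integral_of_dominated_convergence (fun _ => (√k * ‖S‖) ^ k) (fun n => ?_)
    (integrable_const _) (fun n => Eventually.of_forall fun x =>
      Matrix.abs_det_le_sqrt_mul_pow _ fun i j => S.norm_coe_le_norm _)
    (Eventually.of_forall fun x => ?_)
  · exact (hdet.measurable.comp (measurable_pi_lambda _ fun j =>
      (measurable_stepPoint n).comp (measurable_pi_apply j))).aestronglyMeasurable
  · exact (hdet.tendsto x).comp (tendsto_pi_nhds.2 fun j => tendsto_stepPoint (x j))

/-- The bound on Fredholm coefficients given by Hadamard's inequality. -/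
noncomputable def fredholmBound (M : ℝ) (k : ℕ) : ℝ := 1 / (k.factorial : ℝ) * (√k * M) ^ k

theorem abs_fredholmCoeff_le (S : C(I × I, ℝ)) (k : ℕ) :
    |fredholmCoeff S k| ≤ fredholmBound ‖S‖ k := by
  rw [fredholmCoeff, abs_mul, abs_div, abs_pow, abs_neg, abs_one, one_pow, Nat.abs_cast,
    fredholmBound]
  gcongr
  exact abs_integral_det_le S k id

theorem abs_sampledCoeff_le (S : C(I × I, ℝ)) (n k : ℕ) :
    |sampledCoeff S n k| ≤ fredholmBound ‖S‖ k := by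
  rw [sampledCoeff_eq_integral, abs_mul, abs_div, abs_pow, abs_neg, abs_one, one_pow, Nat.abs_cast,
    fredholmBound]
  gcongr
  exact abs_integral_det_le S k _

/-- From `k^k ≤ e^k k!`, the square of the `k`-th term `q` is at most `(M²e)^k / k! = p²z`, with `p
= 2^{-k}` and `z = y^k / k!`; the `4` in `y` compensates `p²`. As `p ≤ 1`, this gives `q ≤ p + z`,
and both majorants are summable. -/
theorem summable_fredholmBound (M : ℝ) (hM : 0 ≤ M) : Summable (fredholmBound M) := by
  set y : ℝ := 4 * M ^ 2 * Real.exp 1 with hy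
  refine Summable.of_nonneg_of_le (fun k => by rw [fredholmBound]; positivity) (fun k => ?_)
    (summable_geometric_two.add (Real.summable_pow_div_factorial y))
  have hf : (0 : ℝ) < k.factorial := by positivity
  have h1 : (k : ℝ) ^ k ≤ Real.exp 1 ^ k * k.factorial := by
    have := Real.pow_div_factorial_le_exp (k : ℝ) (by positivity) k
    rw [div_le_iff₀ hf] at this
    simpa [← Real.exp_nat_mul] using this
  set p : ℝ := (1 / 2) ^ k with hp
  set q : ℝ := fredholmBound M k with hq
  have hp0 : 0 < p := by positivity
  have hq0 : 0 ≤ q := by rw [hq, fredholmBound]; positivity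
  have h2 : q ^ 2 ≤ (M ^ 2 * Real.exp 1) ^ k / k.factorial := by
    have : q ^ 2 = (k : ℝ) ^ k * M ^ (2 * k) / (k.factorial : ℝ) ^ 2 := by
      rw [hq, fredholmBound, mul_pow, mul_pow, mul_pow, ← pow_mul, ← pow_mul, mul_comm k 2,
        pow_mul, Real.sq_sqrt (by positivity)]
      field_simp
    rw [this, div_le_div_iff₀ (by positivity) hf]
    calc (k : ℝ) ^ k * M ^ (2 * k) * k.factorial
        ≤ (Real.exp 1 ^ k * k.factorial) * M ^ (2 * k) * k.factorial := by gcongr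
      _ = _ := by rw [mul_pow, ← pow_mul]; ring
  have h3 : p ^ 2 * (y ^ k / k.factorial) = (M ^ 2 * Real.exp 1) ^ k / k.factorial := by
    rw [hp, hy, ← pow_mul, mul_comm k 2, pow_mul, ← mul_div_assoc, ← mul_pow]
    congr 2
    ring
  set z : ℝ := y ^ k / k.factorial with hz
  have hz0 : 0 ≤ z := by positivity
  by_contra! hlt
  have hp1 : p ≤ 1 := pow_le_one₀ (by norm_num) (by norm_num)
  nlinarith [mul_nonneg hp0.le hz0, mul_nonneg hz0 hz0, mul_nonneg hz0 (sub_nonneg.2 hp1),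
    mul_nonneg (mul_nonneg hp0.le hz0) (sub_nonneg.2 hp1)]

theorem tendsto_tsum_abs_sampledCoeff_sub (S : C(I × I, ℝ)) :
    Tendsto (fun n => ∑' k, |sampledCoeff S n k - fredholmCoeff S k|) atTop (𝓝 0) := by
  have := tendsto_tsum_of_dominated_convergence
    (f := fun n k => |sampledCoeff S n k - fredholmCoeff S k|) (g := fun _ => (0 : ℝ))
    (𝓕 := atTop) (bound := fun k => 2 * fredholmBound ‖S‖ k)
    ((summable_fredholmBound ‖S‖ (norm_nonneg S)).mul_left 2) (fun k => by
      simpa using ((tendsto_sampledCoeff S k).sub_const (fredholmCoeff S k)).abs)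
    (Eventually.of_forall fun n k => by
      rw [Real.norm_eq_abs, abs_abs, two_mul]
      exact (abs_sub _ _).trans (add_le_add (abs_sampledCoeff_le S n k) (abs_fredholmCoeff_le S k)))
  simpa using this

/-- The bound does not depend on `γ`, so it also applies at a minimiser that varies with `n`. -/
theorem abs_det_sub_fredholmDet_le (S : C(I × I, ℝ)) (n : ℕ) {γ : ℝ} (hγ : |γ| ≤ 1) :
    |(1 - γ • sampledMatrix S (n + 1)).det - fredholmDet (γ • S)| ≤
      ∑' k, |sampledCoeff S n k - fredholmCoeff S k| := by
  have hb := summable_fredholmBound ‖S‖ (norm_nonneg S)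
  have hγk : ∀ k : ℕ, |γ ^ k| ≤ 1 := fun k => by
    rw [abs_pow]
    exact pow_le_one₀ (abs_nonneg _) hγ
  have h1 : Summable fun k => sampledCoeff S n k * γ ^ k :=
    Summable.of_norm_bounded hb fun k => by
      rw [norm_mul]
      exact (mul_le_of_le_one_right (norm_nonneg _) (hγk k)).trans (abs_sampledCoeff_le S n k)
  have h2 : Summable fun k => fredholmCoeff S k * γ ^ k :=
    Summable.of_norm_bounded hb fun k => by
      rw [norm_mul]
      exact (mul_le_of_le_one_right (norm_nonneg _) (hγk k)).trans (abs_fredholmCoeff_le S k)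
  have h3 : Summable fun k => |sampledCoeff S n k - fredholmCoeff S k| :=
    Summable.of_nonneg_of_le (fun _ => abs_nonneg _) (fun k => by
      rw [two_mul]
      exact (abs_sub _ _).trans (add_le_add (abs_sampledCoeff_le S n k) (abs_fredholmCoeff_le S k)))
      (hb.mul_left 2)
  rw [det_one_sub_smul_sampledMatrix, fredholmDet_smul, ← h1.tsum_sub h2,
    ← Real.norm_eq_abs]
  refine tsum_of_norm_bounded h3.hasSum fun k => ?_
  rw [← sub_mul, norm_mul]
  exact mul_le_of_le_one_right (norm_nonneg _) (hγk k)

theorem tendsto_det_one_sub_smul_sampledMatrix (S : C(I × I, ℝ)) {γ : ℝ} (hγ : |γ| ≤ 1) :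
    Tendsto (fun n => (1 - γ • sampledMatrix S n).det) atTop (𝓝 (fredholmDet (γ • S))) := by
  rw [← tendsto_add_atTop_iff_nat 1]
  refine tendsto_iff_dist_tendsto_zero.2 (squeeze_zero (fun _ => dist_nonneg) (fun n => ?_)
    (tendsto_tsum_abs_sampledCoeff_sub S))
  rw [Real.dist_eq]
  exact abs_det_sub_fredholmDet_le S n hγ

/-! ### Iterated kernels and traces. -/

/-- The column `S(·, y)` of the kernel as a continuous complex function. -/
noncomputable def kernelColumn (S : C(I × I, ℝ)) (y : I) : C(I, ℂ) :=
  ⟨fun x => (S (x, y) : ℂ), by fun_prop⟩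

/-- The columns of the kernel of the `(k + 1)`-st power of the integral operator. -/
noncomputable def iteratedColumn (S : C(I × I, ℝ)) (k : ℕ) (y : I) : C(I, ℂ) :=
  (kernelOperator S ^ k) (kernelColumn S y)

theorem iteratedColumn_succ_apply (S : C(I × I, ℝ)) (k : ℕ) (y x : I) :
    iteratedColumn S (k + 1) y x = ∫ z : I, (S (x, z) : ℂ) * iteratedColumn S k y z := by
  rw [iteratedColumn, pow_succ']
  rfl

theorem norm_iteratedColumn_apply_le (S : C(I × I, ℝ)) (k : ℕ) (y x : I) :
    ‖iteratedColumn S k y x‖ ≤ ‖kernelOperator S ^ k‖ * ‖S‖ := by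
  refine ((iteratedColumn S k y).norm_coe_le_norm x).trans ?_
  refine ((kernelOperator S ^ k).le_opNorm _).trans ?_
  gcongr
  refine (ContinuousMap.norm_le _ (norm_nonneg _)).2 fun z => ?_
  simpa [kernelColumn] using S.norm_coe_le_norm (z, y)

/-- The kernel of the `(k + 1)`-st power of the integral operator, with Riemann sums at `n + 1`
points in place of integrals. -/
noncomputable def discreteKernel (S : C(I × I, ℝ)) (n : ℕ) : ℕ → I → I → ℝ
  | 0 => fun x y => S (x, y)
  | k + 1 => fun x y => (1 / ((n : ℝ) + 1)) * ∑ i : Fin (n + 1),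
      S (x, samplePoint (n + 1) i) * discreteKernel S n k (samplePoint (n + 1) i) y

theorem discreteKernel_nonneg {S : C(I × I, ℝ)} (hS : ∀ p, 0 ≤ S p) (n k : ℕ) (x y : I) :
    0 ≤ discreteKernel S n k x y := by
  induction k generalizing x with
  | zero => exact hS _
  | succ k ih =>
    exact mul_nonneg (by positivity)
      (Finset.sum_nonneg fun i _ => mul_nonneg (hS _) (ih _))

theorem discreteKernel_succ_eq_integral (S : C(I × I, ℝ)) (n k : ℕ) (x y : I) :
    discreteKernel S n (k + 1) x y =
      ∫ z : I, S (x, stepPoint n z) * discreteKernel S n k (stepPoint n z) y :=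
  (integral_comp_stepIndex fun i : Fin (n + 1) =>
    S (x, samplePoint (n + 1) i) * discreteKernel S n k (samplePoint (n + 1) i) y).symm

theorem abs_discreteKernel_le (S : C(I × I, ℝ)) (n k : ℕ) (x y : I) :
    |discreteKernel S n k x y| ≤ ‖S‖ ^ (k + 1) := by
  induction k generalizing x with
  | zero => simpa [discreteKernel] using S.norm_coe_le_norm (x, y)
  | succ k ih =>
    rw [discreteKernel_succ_eq_integral]
    have := norm_integral_le_of_norm_le_const (μ := (volume : Measure I))
      (f := fun z => S (x, stepPoint n z) * discreteKernel S n k (stepPoint n z) y)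
      (C := ‖S‖ * ‖S‖ ^ (k + 1)) (Eventually.of_forall fun z => by
        rw [norm_mul]
        exact mul_le_mul (S.norm_coe_le_norm _) (ih _) (norm_nonneg _) (norm_nonneg _))
    simpa [pow_succ'] using this

theorem sampledMatrix_pow_apply (S : C(I × I, ℝ)) (n k : ℕ) (i j : Fin (n + 1)) :
    (sampledMatrix S (n + 1) ^ (k + 1)) i j =
      (1 / ((n : ℝ) + 1)) *
        discreteKernel S n k (samplePoint (n + 1) i) (samplePoint (n + 1) j) := by
  induction k generalizing i with
  | zero => simp [sampledMatrix, discreteKernel, div_eq_inv_mul]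
  | succ k ih =>
    rw [pow_succ', Matrix.mul_apply, discreteKernel]
    simp_rw [ih]
    rw [Finset.mul_sum, Finset.mul_sum]
    refine Finset.sum_congr rfl fun l _ => ?_
    simp only [sampledMatrix, Matrix.of_apply]
    push_cast
    ring

theorem trace_sampledMatrix_pow (S : C(I × I, ℝ)) (n k : ℕ) :
    (sampledMatrix S (n + 1) ^ (k + 1)).trace =
      ∫ z : I, discreteKernel S n k (stepPoint n z) (stepPoint n z) := by
  have := integral_comp_stepIndex (n := n) fun i => discreteKernel S n k
    (samplePoint (n + 1) i) (samplePoint (n + 1) i)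
  rw [show (∫ z : I, discreteKernel S n k (stepPoint n z) (stepPoint n z)) = _ from this,
    smul_eq_mul, Finset.mul_sum]
  exact Finset.sum_congr rfl fun i _ => sampledMatrix_pow_apply S n k i i

/-- Both arguments may move with `n`, since the matrix traces evaluate the kernel at `stepPoint n z`
rather than at `z`. The induction peels off one integration in the first variable. -/
theorem tendsto_discreteKernel (S : C(I × I, ℝ)) (k : ℕ) {x y : ℕ → I} {x₀ y₀ : I}
    (hx : Tendsto x atTop (𝓝 x₀)) (hy : Tendsto y atTop (𝓝 y₀)) :
    Tendsto (fun n => (discreteKernel S n k (x n) (y n) : ℂ)) atTop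
      (𝓝 (iteratedColumn S k y₀ x₀)) := by
  induction k generalizing x x₀ with
  | zero =>
    have h : Continuous fun p : I × I => (S p : ℂ) := by fun_prop
    exact (h.tendsto (x₀, y₀)).comp (hx.prodMk_nhds hy)
  | succ k ih =>
    rw [iteratedColumn_succ_apply]
    simp_rw [discreteKernel_succ_eq_integral, ← integral_complex_ofReal]
    refine tendsto_integral_of_dominated_convergence (fun _ => ‖S‖ * ‖S‖ ^ (k + 1)) (fun n => ?_)
      (integrable_const _) (fun n => Eventually.of_forall fun z => ?_)
      (Eventually.of_forall fun z => ?_)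
    · exact ((StronglyMeasurable.of_discrete (f := fun i : Fin (n + 1) =>
        ((S (x n, samplePoint (n + 1) i) *
          discreteKernel S n k (samplePoint (n + 1) i) (y n) : ℝ) : ℂ))).comp_measurable
        (measurable_stepIndex n)).aestronglyMeasurable
    · rw [Complex.norm_real, norm_mul]
      exact mul_le_mul (S.norm_coe_le_norm _) (abs_discreteKernel_le S n k _ _) (norm_nonneg _)
        (norm_nonneg _)
    · push_cast
      have h : Continuous fun p : I × I => (S p : ℂ) := by fun_prop
      exact ((h.tendsto (x₀, z)).comp (hx.prodMk_nhds (tendsto_stepPoint z))).mul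
        (ih (tendsto_stepPoint z))

/-- The trace of the `(k + 1)`-st power of the integral operator. -/
noncomputable def kernelTrace (S : C(I × I, ℝ)) (k : ℕ) : ℝ :=
  ∫ z : I, (iteratedColumn S k z z).re

theorem tendsto_trace_sampledMatrix_pow (S : C(I × I, ℝ)) (k : ℕ) :
    Tendsto (fun n => (sampledMatrix S (n + 1) ^ (k + 1)).trace) atTop (𝓝 (kernelTrace S k)) := by
  simp_rw [trace_sampledMatrix_pow]
  refine tendsto_integral_of_dominated_convergence (fun _ => ‖S‖ ^ (k + 1)) (fun n => ?_)
    (integrable_const _)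
    (fun n => Eventually.of_forall fun z => abs_discreteKernel_le S n k _ _)
    (Eventually.of_forall fun z => ?_)
  · exact ((StronglyMeasurable.of_discrete (f := fun i : Fin (n + 1) =>
      discreteKernel S n k (samplePoint (n + 1) i) (samplePoint (n + 1) i))).comp_measurable
      (measurable_stepIndex n)).aestronglyMeasurable
  · exact (Complex.continuous_re.tendsto _).comp
      (tendsto_discreteKernel S k (tendsto_stepPoint z) (tendsto_stepPoint z))

theorem kernelTrace_nonneg {S : C(I × I, ℝ)} (hS : ∀ p, 0 ≤ S p) (k : ℕ) :
    0 ≤ kernelTrace S k := by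
  refine ge_of_tendsto' (tendsto_trace_sampledMatrix_pow S k) fun n => ?_
  rw [trace_sampledMatrix_pow]
  exact integral_nonneg fun z => discreteKernel_nonneg hS n k _ _

/-- This bound by operator norms of powers is where the spectral radius gains control of the traces.
-/
theorem abs_kernelTrace_le (S : C(I × I, ℝ)) (k : ℕ) :
    |kernelTrace S k| ≤ ‖kernelOperator S ^ k‖ * ‖S‖ := by
  have := norm_integral_le_of_norm_le_const (μ := (volume : Measure I))
    (f := fun z => (iteratedColumn S k z z).re) (C := ‖kernelOperator S ^ k‖ * ‖S‖)
    (Eventually.of_forall fun z =>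
      (Complex.abs_re_le_norm _).trans (norm_iteratedColumn_apply_le S k z z))
  simpa [kernelTrace] using this

theorem abs_trace_sampledMatrix_pow_le (S : C(I × I, ℝ)) (n k : ℕ) :
    |(sampledMatrix S (n + 1) ^ (k + 1)).trace| ≤ ‖S‖ ^ (k + 1) := by
  rw [trace_sampledMatrix_pow]
  have := norm_integral_le_of_norm_le_const (μ := (volume : Measure I))
    (f := fun z => discreteKernel S n k (stepPoint n z) (stepPoint n z)) (C := ‖S‖ ^ (k + 1))
    (Eventually.of_forall fun z => abs_discreteKernel_le S n k _ _)
  simpa using this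

-- A row has `n + 1` entries of size at most `‖S‖ / (n + 1)`. The row-sum norm is thus bounded
-- uniformly in `n`, so one range of `γ` serves for Plemelj's formula at all `n`.
open scoped Matrix.Norms.Operator in
theorem norm_sampledMatrix_le (S : C(I × I, ℝ)) (n : ℕ) :
    ‖sampledMatrix S (n + 1)‖ ≤ ‖S‖ := by
  rw [Matrix.linfty_opNorm_def, ← coe_nnnorm, NNReal.coe_le_coe]
  refine Finset.sup_le fun i _ => ?_
  rw [← NNReal.coe_le_coe]
  push_cast
  calc ∑ j, ‖sampledMatrix S (n + 1) i j‖ ≤ ∑ _j : Fin (n + 1), ‖S‖ / (n + 1) := by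
        refine Finset.sum_le_sum fun j _ => ?_
        simp only [sampledMatrix, Matrix.of_apply, norm_div]
        have h : ‖((n + 1 : ℕ) : ℝ)‖ = n + 1 := by
          rw [Real.norm_natCast]
          push_cast
          rfl
        rw [h]
        gcongr
        exact S.norm_coe_le_norm _
    _ = ‖S‖ := by
        have : (n : ℝ) + 1 ≠ 0 := by positivity
        simp
        field_simp

/-! ### Plemelj's formula for the Fredholm determinant. -/

/-- Plemelj's formula for small parameters. -/
theorem fredholmDet_smul_eq_exp_of_abs_mul_norm_lt_one (S : C(I × I, ℝ)) {γ : ℝ} (hγ : |γ| ≤ 1)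
    (h : |γ| * ‖S‖ < 1) :
    fredholmDet (γ • S) = Real.exp (-∑' k : ℕ, kernelTrace S k / (k + 1) * γ ^ (k + 1)) := by
  have h1 := (tendsto_add_atTop_iff_nat 1).2 (tendsto_det_one_sub_smul_sampledMatrix S hγ)
  refine tendsto_nhds_unique h1 ?_
  have h2 : ∀ n, (1 - γ • sampledMatrix S (n + 1)).det = Real.exp (-∑' k : ℕ,
      (sampledMatrix S (n + 1) ^ (k + 1)).trace / (k + 1) * γ ^ (k + 1)) := fun n =>
    Matrix.det_one_sub_smul_eq_exp _ ((mul_le_mul_of_nonneg_left (norm_sampledMatrix_le S n)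
      (abs_nonneg γ)).trans_lt h)
  simp_rw [h2]
  refine (Real.continuous_exp.tendsto _).comp (Tendsto.neg ?_)
  -- The dominating series must be independent of `n`; this geometric one converges only because
  -- `|γ| ‖S‖ < 1`.
  refine tendsto_tsum_of_dominated_convergence (bound := fun k => (|γ| * ‖S‖) ^ (k + 1))
    ((summable_nat_add_iff 1).2 (summable_geometric_of_lt_one (by positivity) h)) (fun k => ?_)
    (Eventually.of_forall fun n k => ?_)
  · exact ((tendsto_trace_sampledMatrix_pow S k).div_const _).mul_const _
  · rw [norm_mul, norm_div, norm_pow, Real.norm_eq_abs γ, mul_pow, mul_comm]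
    gcongr
    refine (div_le_self (norm_nonneg _) ?_).trans (abs_trace_sampledMatrix_pow_le S n k)
    rw [Real.norm_eq_abs, abs_of_pos (by positivity)]
    linarith [Nat.cast_nonneg (α := ℝ) k]

theorem analyticOnNhd_tsum_mul_pow {c : ℕ → ℝ} {r : ℝ} (hc : Summable fun k => |c k| * r ^ k) :
    AnalyticOnNhd ℝ (fun x : ℝ => ∑' k, c k * x ^ k) (Metric.ball 0 r) := by
  rcases le_or_gt r 0 with hr | hr
  · simp [Metric.ball_eq_empty.2 hr]
  lift r to NNReal using hr.le
  set p := FormalMultilinearSeries.ofScalars ℝ c with hp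
  have hrad : (r : ENNReal) ≤ p.radius := by
    refine p.le_radius_of_summable_norm ?_
    simpa [hp, FormalMultilinearSeries.ofScalars_norm] using hc
  have h := (p.hasFPowerSeriesOnBall
    ((ENNReal.coe_pos.2 (by exact_mod_cast hr)).trans_le hrad)).analyticOnNhd
  have hsum : p.sum = fun x : ℝ => ∑' k, c k * x ^ k :=
    FormalMultilinearSeries.ofScalarsSum_eq_tsum c
  rw [hsum] at h
  refine h.mono fun x hx => ?_
  rw [← Metric.eball_coe] at hx
  exact Metric.eball_subset_eball hrad hx

theorem eventually_norm_pow_le_pow {A : Type*} [NormedRing A] [NormedAlgebra ℂ A] [CompleteSpace A]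
    (a : A) {R : ℝ} (h : spectralRadius ℂ a < ENNReal.ofReal R) :
    ∀ᶠ k : ℕ in atTop, ‖a ^ k‖ ≤ R ^ k := by
  filter_upwards [(spectrum.pow_norm_pow_one_div_tendsto_nhds_spectralRadius a).eventually_lt_const
    h, eventually_gt_atTop 0] with k hk hk0
  have h1 : ‖a ^ k‖ ^ (1 / k : ℝ) ≤ R := ((ENNReal.ofReal_lt_ofReal_iff_of_nonneg
    (by positivity)).1 hk).le
  calc ‖a ^ k‖ = (‖a ^ k‖ ^ (1 / k : ℝ)) ^ k := by
        rw [one_div, Real.rpow_inv_natCast_pow (norm_nonneg _) hk0.ne']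
    _ ≤ R ^ k := by gcongr

theorem summable_abs_kernelTrace_mul_pow {S : C(I × I, ℝ)} (hρ : kernelSpectralRadius S ≤ 1)
    {r : ℝ} (hr0 : 0 ≤ r) (hr : r < 1) : Summable fun k => |kernelTrace S k| * r ^ k := by
  -- `R` lies strictly between `1` and `1 / r` when `r > 0`: above the spectral radius, so that
  -- Gelfand's formula bounds the powers by `R ^ k`, yet with `R * r < 1`.
  set R : ℝ := 2 / (1 + r) with hR
  have hR1 : 1 < R := by rw [hR, lt_div_iff₀ (by linarith)]; linarith
  have hRr : R * r < 1 := by rw [hR, div_mul_eq_mul_div, div_lt_one (by linarith)]; linarith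
  have hRr0 : 0 ≤ R * r := by positivity
  have hev := eventually_norm_pow_le_pow (kernelOperator S) (R := R)
    (hρ.trans_lt (by rw [← ENNReal.ofReal_one, ENNReal.ofReal_lt_ofReal_iff (by linarith)]
                     exact hR1))
  refine Summable.of_norm_bounded_eventually_nat
    ((summable_geometric_of_lt_one hRr0 hRr).mul_left ‖S‖) ?_
  filter_upwards [hev] with k hk
  rw [norm_mul, Real.norm_eq_abs, abs_abs, norm_pow, Real.norm_of_nonneg hr0, mul_pow,
    ← mul_assoc]
  gcongr
  refine (abs_kernelTrace_le S k).trans ?_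
  rw [mul_comm]
  gcongr

/-- Plemelj's formula up to the reciprocal of the spectral radius. -/
theorem fredholmDet_smul_eq_exp {S : C(I × I, ℝ)} (hρ : kernelSpectralRadius S ≤ 1) {γ : ℝ}
    (hγ : |γ| < 1) :
    fredholmDet (γ • S) = Real.exp (-∑' k : ℕ, kernelTrace S k / (k + 1) * γ ^ (k + 1)) := by
  obtain ⟨r, hγr, hr⟩ := exists_between hγ
  have hr0 : 0 < r := (abs_nonneg γ).trans_lt hγr
  have hd : AnalyticOnNhd ℝ (fun x : ℝ => fredholmDet (x • S)) (Metric.ball 0 r) := by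
    simp_rw [fredholmDet_smul]
    refine analyticOnNhd_tsum_mul_pow (Summable.of_nonneg_of_le (fun k => by positivity)
      (fun k => ?_) (summable_fredholmBound ‖S‖ (norm_nonneg S)))
    exact (mul_le_of_le_one_right (abs_nonneg _) (pow_le_one₀ hr0.le hr.le)).trans
      (abs_fredholmCoeff_le S k)
  have hL : AnalyticOnNhd ℝ (fun x : ℝ => ∑' k : ℕ, kernelTrace S k / (k + 1) * x ^ (k + 1))
      (Metric.ball 0 r) := by
    have h : (fun x : ℝ => ∑' k : ℕ, kernelTrace S k / (k + 1) * x ^ (k + 1)) =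
        fun x => x * ∑' k : ℕ, kernelTrace S k / (k + 1) * x ^ k := by
      funext x
      rw [← tsum_mul_left]
      exact tsum_congr fun k => by ring
    rw [h]
    refine analyticOnNhd_id.mul (analyticOnNhd_tsum_mul_pow (Summable.of_nonneg_of_le
      (fun k => by positivity) (fun k => ?_)
      (summable_abs_kernelTrace_mul_pow hρ hr0.le hr)))
    rw [abs_div, abs_of_pos (show (0 : ℝ) < k + 1 by positivity)]
    gcongr
    exact div_le_self (abs_nonneg _) (by linarith [Nat.cast_nonneg (α := ℝ) k])
  have hE : AnalyticOnNhd ℝ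
      (fun x : ℝ => Real.exp (-∑' k : ℕ, kernelTrace S k / (k + 1) * x ^ (k + 1)))
      (Metric.ball 0 r) := fun x hx => (hL x hx).neg.rexp
  -- Identity theorem: both sides are analytic on the ball and agree near `0`.
  refine hd.eqOn_of_preconnected_of_eventuallyEq hE (convex_ball 0 r).isPreconnected
    (Metric.mem_ball_self hr0) ?_ (show γ ∈ Metric.ball (0 : ℝ) r by simpa using hγr)
  have h1 : ∀ᶠ x : ℝ in 𝓝 0, |x| < 1 :=
    (continuous_abs.tendsto (0 : ℝ)).eventually_lt_const (by simp)
  have h2 : ∀ᶠ x : ℝ in 𝓝 0, |x| * ‖S‖ < 1 :=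
    ((continuous_abs.mul continuous_const).tendsto (0 : ℝ)).eventually_lt_const (by simp)
  filter_upwards [h1, h2] with x hx1 hx2
  exact fredholmDet_smul_eq_exp_of_abs_mul_norm_lt_one S hx1.le hx2

/-! ### Monotonicity in the parameter and convergence of the minima. -/

theorem antitoneOn_fredholmDet_smul {S : C(I × I, ℝ)} (hS : ∀ p, 0 ≤ S p)
    (hρ : kernelSpectralRadius S ≤ 1) :
    AntitoneOn (fun γ : ℝ => fredholmDet (γ • S)) (Set.Ico 0 1) := by
  have hs : ∀ x ∈ Set.Ico (0 : ℝ) 1,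
      Summable fun k : ℕ => kernelTrace S k / (k + 1) * x ^ (k + 1) := fun x hx => by
    refine Summable.of_norm_bounded (summable_abs_kernelTrace_mul_pow hρ hx.1 hx.2) fun k => ?_
    rw [norm_mul, norm_div, norm_pow, Real.norm_of_nonneg hx.1,
      Real.norm_of_nonneg (show (0 : ℝ) ≤ k + 1 by positivity), Real.norm_eq_abs]
    refine mul_le_mul (div_le_self (abs_nonneg _) (by linarith [Nat.cast_nonneg (α := ℝ) k]))
      (pow_le_pow_of_le_one hx.1 hx.2.le k.le_succ) (pow_nonneg hx.1 _) (abs_nonneg _)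
  intro x hx y hy hxy
  have habs : ∀ z ∈ Set.Ico (0 : ℝ) 1, |z| < 1 := fun z hz => by rw [abs_of_nonneg hz.1]; exact hz.2
  simp only [fredholmDet_smul_eq_exp hρ (habs x hx), fredholmDet_smul_eq_exp hρ (habs y hy)]
  refine Real.exp_le_exp.2 (neg_le_neg ((hs x hx).tsum_le_tsum (fun k => ?_) (hs y hy)))
  have := kernelTrace_nonneg hS k
  have := hx.1
  gcongr

theorem mainTheorem6 (S : C(I × I, ℝ)) (hS : ∀ p, 0 ≤ S p)
    (hρ : kernelSpectralRadius S = 1 ∨ kernelSpectralRadius S = 0)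
    (ε : ℝ) (hε : ε ∈ Set.Ioc (0 : ℝ) 1) :
    (∃ m : ℕ → ℝ,
      (∀ n : ℕ, IsLeast
        ((fun γ : ℝ => (1 - γ • sampledMatrix S n).det) '' Set.Icc 0 (1 - ε)) (m n)) ∧
      Tendsto m atTop (𝓝 (fredholmDet ((1 - ε) • S)))) ∧
    Tendsto (fun n : ℕ => (1 - (1 - ε) • sampledMatrix S n).det) atTop
      (𝓝 (fredholmDet ((1 - ε) • S))) ∧
    0 < fredholmDet ((1 - ε) • S) := by
  have hρ' : kernelSpectralRadius S ≤ 1 := by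
    rcases hρ with h | h <;> simp [h]
  obtain ⟨hε0, hε1⟩ := hε
  have ha : |1 - ε| < 1 := by rw [abs_of_nonneg (by linarith)]; linarith
  refine ⟨?_, tendsto_det_one_sub_smul_sampledMatrix S ha.le, ?_⟩
  · have hleast : ∀ n : ℕ, ∃ m, IsLeast
        ((fun γ : ℝ => (1 - γ • sampledMatrix S n).det) '' Set.Icc 0 (1 - ε)) m := fun n => by
      refine (isCompact_Icc.image ?_).exists_isLeast
        ((Set.nonempty_Icc.2 (by linarith)).image _)
      exact Continuous.matrix_det (by fun_prop)
    choose m hm using hleast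
    refine ⟨m, hm, ?_⟩
    rw [← tendsto_add_atTop_iff_nat 1]
    refine tendsto_iff_dist_tendsto_zero.2 (squeeze_zero (fun _ => dist_nonneg) (fun n => ?_)
      (tendsto_tsum_abs_sampledCoeff_sub S))
    rw [Real.dist_eq, abs_le]
    -- With `δ` the uniform error, minimality gives `m ≤ d(1 - ε) ≤ D(1 - ε) + δ`. At a minimiser
    -- `γ`, monotonicity of `D` gives `m = d(γ) ≥ D(γ) - δ ≥ D(1 - ε) - δ`.
    obtain ⟨γ, ⟨hγ0, hγ1⟩, hγ⟩ := (hm (n + 1)).1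
    have h1 := (hm (n + 1)).2 ⟨1 - ε, ⟨by linarith, le_rfl⟩, rfl⟩
    have h2 := abs_le.1 (abs_det_sub_fredholmDet_le S n ha.le)
    have h3 := abs_le.1 (abs_det_sub_fredholmDet_le S n
      (show |γ| ≤ 1 by rw [abs_of_nonneg hγ0]; linarith))
    have h4 := antitoneOn_fredholmDet_smul hS hρ' ⟨hγ0, by linarith⟩
      ⟨by linarith, by linarith⟩ hγ1
    simp only at h1 h4 hγ
    constructor <;> linarith [h2.1, h2.2, h3.1, h3.2]
  · rw [fredholmDet_smul_eq_exp hρ' ha]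
    exact Real.exp_pos _
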